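/- Let $p$ be a prime number and $n$ a positive integer, and let $G=\mathrm{PSL}(2,p^n)$ be the quotient of the special linear group $\mathrm{SL}(2,\mathbb{F})$ over a field $\mathbb{F}$ with $p^n$ elements by its centre. If $r$ is an odd prime dividing $p^n+1$, then $G$ has exactly $\frac{p^n(p^n-1)}{2}$ Sylow $r$-subgroups, and any two distinct Sylow $r$-subgroups of $G$ intersect trivially. If $q$ is an odd prime dividing $p^n-1$, then $G$ has exactly $\frac{p^n(p^n+1)}{2}$ Sylow $q$-subgroups, and any two distinct Sylow $q$-subgroups of $G$ intersect trivially. Moreover, if $r$ and $q$ are odd primes with $r\mid p^n+1$ and $q\mid p^n-1$, then every Sylow $r$-subgroup of $G$ intersects every Sylow $q$-subgroup of $G$ trivially. -/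

import Mathlib

/-! ### Sylow subgroups in groups where commuting is transitive off the centre -/

section AbstractGroups

variable {G H : Type*} [Group G] [Group H] {r : ℕ}

/-! Write `Q = p ^ n`. In SL₂ the centre has exponent dividing 2, and commuting is transitive
through noncentral elements. For odd `r` this makes Sylow `r`-subgroups abelian, and two that share
`x ≠ 1` centralise each other, hence coincide. The kernel of SL₂ → PSL₂ is invisible to odd `r`, so
both the count and the trivial intersections descend.

To count, take `g` of order `r` in SL₂, with trace `t`. Every element of trace `t` has `r`-th power
1, so it lies in a unique Sylow subgroup; each Sylow subgroup contains exactly two such elements, a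
conjugate of `g` and its inverse. Hence twice the Sylow count is the number of determinant-one
matrices of trace `t`, namely `Q² - Q + Q·N`, where `N` counts the roots of `X² - tX + 1` in `F`: `N
= 2` if `r ∣ Q - 1`, and `N = 0` if `r ∣ Q + 1`. No odd prime divides both `Q - 1` and `Q + 1`,
which gives the last claim. -/

theorem IsPGroup.exists_eq_sq_zpow {P : Subgroup G} (hP : IsPGroup r P) (hr : Odd r) {x : G}
    (hx : x ∈ P) : ∃ m : ℤ, x = (x ^ 2) ^ m := by
  obtain ⟨k, hk⟩ := hP ⟨x, hx⟩
  obtain ⟨m, hm⟩ := hr.pow (n := k)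
  have hk' : x ^ (2 * m + 1) = 1 := by
    rw [← hm]
    exact congrArg Subtype.val hk
  refine ⟨-m, ?_⟩
  rw [zpow_neg, zpow_natCast, ← pow_mul, eq_inv_iff_mul_eq_one, ← pow_succ']
  exact hk'

theorem IsPGroup.eq_one_of_sq_eq_one {P : Subgroup G} (hP : IsPGroup r P) (hr : Odd r) {x : G}
    (hx : x ∈ P) (h : x ^ 2 = 1) : x = 1 := by
  obtain ⟨m, hm⟩ := hP.exists_eq_sq_zpow hr hx
  rw [hm, h, one_zpow]

/-- A nontrivial `r`-group has a nontrivial central element; having odd order, it is not central in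
`G`, so transitivity applies through it. -/
theorem Sylow.commute_of_commute_transitive [Finite G] [Fact r.Prime] (hr : Odd r)
    (hZ : ∀ z ∈ Subgroup.center G, z ^ 2 = 1)
    (hC : ∀ x y z : G, x ∉ Subgroup.center G → Commute x y → Commute x z → Commute y z)
    (P : Sylow r G) {x y : G} (hx : x ∈ P) (hy : y ∈ P) : Commute x y := by
  by_cases hP : Nontrivial P
  · have := P.isPGroup'.center_nontrivial
    obtain ⟨⟨⟨z, hzP⟩, hz⟩, hne⟩ := exists_ne (1 : Subgroup.center P)
    have hz1 : z ≠ 1 := fun h => hne (by ext; exact h)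
    rw [Subgroup.mem_center_iff] at hz
    have key : ∀ w ∈ P, Commute z w := fun w hw =>
      (congrArg Subtype.val (hz ⟨w, hw⟩)).symm
    exact hC z x y (fun h => hz1 (P.isPGroup'.eq_one_of_sq_eq_one hr hzP (hZ z h)))
      (key x hx) (key y hy)
  · rw [not_nontrivial_iff_subsingleton] at hP
    have : x = y := congrArg Subtype.val (Subsingleton.elim (⟨x, hx⟩ : P) ⟨y, hy⟩)
    exact this ▸ Commute.refl x

theorem Sylow.eq_of_mem_of_commute_transitive [Finite G] [Fact r.Prime] (hr : Odd r)
    (hZ : ∀ z ∈ Subgroup.center G, z ^ 2 = 1)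
    (hC : ∀ x y z : G, x ∉ Subgroup.center G → Commute x y → Commute x z → Commute y z)
    (P Q : Sylow r G) {x : G} (hxP : x ∈ P) (hxQ : x ∈ Q) (hx : x ≠ 1) : P = Q := by
  have hxZ : x ∉ Subgroup.center G := fun h =>
    hx (P.isPGroup'.eq_one_of_sq_eq_one hr hxP (hZ x h))
  have hPQ : ∀ a ∈ P, ∀ b ∈ Q, Commute a b := fun a ha b hb =>
    hC x a b hxZ (P.commute_of_commute_transitive hr hZ hC hxP ha)
      (Q.commute_of_commute_transitive hr hZ hC hxQ hb)
  have hle : (P : Subgroup G) ≤ Subgroup.normalizer (Q : Set G) := by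
    intro a ha
    change a ∈ Subgroup.normalizer ((Q : Subgroup G) : Set G)
    rw [Subgroup.mem_normalizer_iff]
    intro b
    constructor
    · intro hb
      rw [(hPQ a ha b hb).eq, mul_inv_cancel_right]
      exact hb
    · intro hb
      have h := hPQ a ha _ hb
      have : a * b * a⁻¹ = b := by
        have h2 := h.eq
        rw [inv_mul_cancel_right] at h2
        exact mul_left_cancel h2
      rwa [this] at hb
  -- An `r`-subgroup normalising a Sylow `r`-subgroup lies inside it.
  have h := P.isPGroup'.inf_normalizer_sylow Q
  rw [inf_eq_left.mpr hle] at h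
  exact Sylow.ext (P.is_maximal' Q.isPGroup' (inf_eq_left.mp h.symm)).symm

/-- `x` and `y` differ by a central element of square 1, so `x ^ 2 = y ^ 2`, and `x` is a power of
its own square. -/
theorem Sylow.mem_of_map_eq {f : G →* H} (hr : Odd r) (hf : ∀ z ∈ f.ker, z ^ 2 = 1)
    (hfc : f.ker ≤ Subgroup.center G) {P Q : Sylow r G} {x y : G} (hx : x ∈ P) (hy : y ∈ Q)
    (h : f x = f y) : x ∈ Q := by
  have hz : y⁻¹ * x ∈ f.ker := by rw [MonoidHom.mem_ker]; simp [h]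
  have hsq : x ^ 2 = y ^ 2 := by
    have h1 := hf _ hz
    have h2 : Commute y (y⁻¹ * x) := Subgroup.mem_center_iff.mp (hfc hz) y
    calc x ^ 2 = (y * (y⁻¹ * x)) ^ 2 := by rw [mul_inv_cancel_left]
      _ = y ^ 2 := by rw [h2.mul_pow, h1, mul_one]
  obtain ⟨m, hm⟩ := P.isPGroup'.exists_eq_sq_zpow hr hx
  rw [hm, hsq]
  exact zpow_mem (pow_mem hy 2) m

theorem Sylow.mapSurjective_injective [Finite G] [Fact r.Prime] {f : G →* H}
    (hs : Function.Surjective f) (hr : Odd r)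
    (hf : ∀ z ∈ f.ker, z ^ 2 = 1) (hfc : f.ker ≤ Subgroup.center G) :
    Function.Injective (Sylow.mapSurjective (p := r) hs) := by
  have key : ∀ P Q : Sylow r G, P.mapSurjective hs = Q.mapSurjective hs →
      (P : Subgroup G) ≤ Q := by
    intro P Q h x hx
    have h1 : f x ∈ Q.mapSurjective hs := h ▸ Subgroup.mem_map_of_mem f hx
    obtain ⟨y, hy, hxy⟩ := h1
    exact Sylow.mem_of_map_eq hr hf hfc hx hy hxy.symm
  intro P Q h
  exact Sylow.ext (le_antisymm (key P Q h) (key Q P h.symm))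

theorem Sylow.card_eq_and_inf_eq_bot_of_surjective [Finite G] [Fact r.Prime] {f : G →* H}
    (hs : Function.Surjective f) (hr : Odd r)
    (hf : ∀ z ∈ f.ker, z ^ 2 = 1) (hfc : f.ker ≤ Subgroup.center G)
    (hG : ∀ (P Q : Sylow r G) (x : G), x ∈ P → x ∈ Q → x ≠ 1 → P = Q) :
    Nat.card (Sylow r H) = Nat.card (Sylow r G) ∧
      ∀ P Q : Sylow r H, P ≠ Q → (P : Subgroup H) ⊓ Q = ⊥ := by
  have hsurj := Sylow.mapSurjective_surjective hs r
  refine ⟨(Nat.card_congr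
    (Equiv.ofBijective _ ⟨Sylow.mapSurjective_injective hs hr hf hfc, hsurj⟩)).symm, ?_⟩
  intro P Q hPQ
  obtain ⟨P, rfl⟩ := hsurj P
  obtain ⟨Q, rfl⟩ := hsurj Q
  rw [eq_bot_iff]
  rintro z ⟨⟨x, hx, rfl⟩, ⟨y, hy, hxy⟩⟩
  have hxQ : x ∈ Q := Sylow.mem_of_map_eq hr hf hfc hx hy hxy.symm
  by_contra hne
  refine hPQ (congrArg _ (hG P Q x hx hxQ ?_))
  rintro rfl
  exact hne (by simp)

/-- If every Sylow subgroup meets `T` in exactly two points and the Sylow subgroups containing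
points of `T` are unique, then `T` has twice as many points as there are Sylow subgroups. -/
theorem Sylow.card_eq_two_mul [Finite G] (T : Set G)
    (h1 : ∀ x ∈ T, ∃! P : Sylow r G, x ∈ P)
    (h2 : ∀ P : Sylow r G, Nat.card {x // x ∈ T ∧ x ∈ P} = 2) :
    Nat.card T = 2 * Nat.card (Sylow r G) := by
  choose s hs hu using h1
  have e : (T : Type _) ≃ Σ P : Sylow r G, {x // x ∈ T ∧ x ∈ P} :=
    { toFun := fun x => ⟨s x.1 x.2, x.1, x.2, hs x.1 x.2⟩
      invFun := fun y => ⟨y.2.1, y.2.2.1⟩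
      left_inv := fun x => rfl
      right_inv := by
        rintro ⟨P, x, hx, hP⟩
        obtain rfl : P = s x hx := hu x hx P hP
        rfl }
  have := Fintype.ofFinite (Sylow r G)
  rw [Nat.card_congr e, Nat.card_sigma]
  simp [h2, mul_comm]

end AbstractGroups


/-! ### Commutation, traces and powers in SL₂ -/

namespace Matrix.SpecialLinearGroup

variable {F : Type*} [Field F]

local notation "SL₂" => SpecialLinearGroup (Fin 2) F

theorem fin_two_det_eq (g : SL₂) : g 0 0 * g 1 1 - g 0 1 * g 1 0 = 1 := by
  rw [← det_fin_two]
  exact g.2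

theorem fin_two_ext {g h : SL₂} (h00 : g 0 0 = h 0 0) (h01 : g 0 1 = h 0 1)
    (h10 : g 1 0 = h 1 0) (h11 : g 1 1 = h 1 1) : g = h := by
  ext i j
  fin_cases i <;> fin_cases j <;> assumption

/-- Modulo scalars a matrix is the vector `(b, c, d - a)`, and the commutator is essentially a cross
product: commuting means these vectors are parallel. -/
theorem fin_two_commute_iff (g h : SL₂) :
    Commute g h ↔ g 0 1 * h 1 0 = h 0 1 * g 1 0 ∧
      g 0 1 * (h 1 1 - h 0 0) = h 0 1 * (g 1 1 - g 0 0) ∧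
      g 1 0 * (h 1 1 - h 0 0) = h 1 0 * (g 1 1 - g 0 0) := by
  rw [commute_iff_eq, SpecialLinearGroup.ext_iff]
  simp only [Fin.forall_fin_two, coe_mul, Matrix.mul_apply, Fin.sum_univ_two]
  constructor
  · rintro ⟨⟨h1, h2⟩, h3, h4⟩
    refine ⟨?_, ?_, ?_⟩
    · linear_combination h1
    · linear_combination h2
    · linear_combination -h3
  · rintro ⟨h1, h2, h3⟩
    refine ⟨⟨?_, ?_⟩, ?_, ?_⟩
    · linear_combination h1
    · linear_combination h2
    · linear_combination -h3
    · linear_combination -h1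

theorem fin_two_mem_center {g : SL₂} (h01 : g 0 1 = 0) (h10 : g 1 0 = 0)
    (h11 : g 1 1 - g 0 0 = 0) : g ∈ Subgroup.center SL₂ := by
  rw [Subgroup.mem_center_iff]
  intro h
  refine ((fin_two_commute_iff g h).mpr ?_).symm
  simp [h01, h10, h11]

theorem fin_two_sq_eq_one_of_mem_center {g : SL₂} (hg : g ∈ Subgroup.center SL₂) :
    g ^ 2 = 1 := by
  obtain ⟨c, hc, hg⟩ := mem_center_iff.mp hg
  apply Subtype.ext
  rw [coe_pow, ← hg, ← map_pow]
  rw [Fintype.card_fin] at hc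
  simp [hc]

/-- Two vectors parallel to the same nonzero vector are parallel. -/
theorem fin_two_commute_of_commute (x y z : SL₂) (hx : x ∉ Subgroup.center SL₂)
    (hy : Commute x y) (hz : Commute x z) : Commute y z := by
  rw [fin_two_commute_iff] at hy hz ⊢
  obtain ⟨a1, a2, a3⟩ := hy
  obtain ⟨b1, b2, b3⟩ := hz
  by_cases h01 : x 0 1 = 0
  · by_cases h10 : x 1 0 = 0
    · have h11 : x 1 1 - x 0 0 ≠ 0 := fun h => hx (fin_two_mem_center h01 h10 h)
      refine ⟨?_, ?_, ?_⟩ <;> apply mul_left_cancel₀ h11 <;> grind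
    · refine ⟨?_, ?_, ?_⟩ <;> apply mul_left_cancel₀ h10 <;> grind
  · refine ⟨?_, ?_, ?_⟩ <;> apply mul_left_cancel₀ h01 <;> grind

theorem fin_two_mul_self (g : SL₂) : (g : Matrix (Fin 2) (Fin 2) F) * g =
    trace (g : Matrix (Fin 2) (Fin 2) F) • (g : Matrix (Fin 2) (Fin 2) F) - 1 := by
  have hd := fin_two_det_eq g
  ext i j
  fin_cases i <;> fin_cases j <;>
    simp [Matrix.mul_apply, Fin.sum_univ_two, trace_fin_two] <;> grind

theorem fin_two_trace_inv (g : SL₂) :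
    trace ((g⁻¹ : SL₂) : Matrix (Fin 2) (Fin 2) F) = trace (g : Matrix (Fin 2) (Fin 2) F) := by
  simp [coe_inv, adjugate_fin_two, trace_fin_two, add_comm]

theorem fin_two_trace_conj (x g : SL₂) :
    trace ((x * g * x⁻¹ : SL₂) : Matrix (Fin 2) (Fin 2) F) =
      trace (g : Matrix (Fin 2) (Fin 2) F) := by
  have h : x⁻¹ * (x * g) = g := inv_mul_cancel_left x g
  rw [coe_mul, trace_mul_comm, ← coe_mul, h]

theorem fin_two_trace_sq (g : SL₂) : trace ((g ^ 2 : SL₂) : Matrix (Fin 2) (Fin 2) F) =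
    trace (g : Matrix (Fin 2) (Fin 2) F) ^ 2 - 2 := by
  rw [coe_pow, pow_two, fin_two_mul_self, trace_sub, trace_smul, trace_one]
  simp [pow_two]

theorem fin_two_eq_one_of_trace_eq_two {g : SL₂} {k : ℕ} (hk : (k : F) ≠ 0) (hg : g ^ k = 1)
    (ht : trace (g : Matrix (Fin 2) (Fin 2) F) = 2) : g = 1 := by
  have h2 := fin_two_mul_self g
  rw [ht] at h2
  -- Trace 2 means `(g - 1)² = 0`, so the binomial expansion stops at the linear term.
  have key : ∀ m : ℕ, (g : Matrix (Fin 2) (Fin 2) F) ^ m =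
      1 + (m : F) • ((g : Matrix (Fin 2) (Fin 2) F) - 1) := by
    intro m
    induction m with
    | zero => simp
    | succ m ih =>
      rw [pow_succ, ih, add_mul, smul_mul_assoc, sub_mul, h2, one_mul]
      push_cast
      module
  have h := key k
  rw [← coe_pow, hg, coe_one, left_eq_add, smul_eq_zero] at h
  exact Subtype.ext (sub_eq_zero.mp (h.resolve_left hk))

theorem fin_two_trace_sq_ne_four {g : SL₂} {k : ℕ} (hk : (k : F) ≠ 0) (ho : Odd k)
    (hg : g ^ k = 1) (h1 : g ≠ 1) : trace (g : Matrix (Fin 2) (Fin 2) F) ^ 2 ≠ 4 := by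
  intro ht
  have h2 : g ^ 2 = 1 := by
    apply fin_two_eq_one_of_trace_eq_two hk
    · rw [← pow_mul, mul_comm, pow_mul, hg, one_pow]
    · rw [fin_two_trace_sq, ht]; norm_num
  obtain ⟨m, rfl⟩ := ho
  apply h1
  rwa [pow_succ, pow_mul, h2, one_pow, one_mul] at hg

/-- The only elements commuting with a regular semisimple `g` and sharing its trace
are `g` and `g⁻¹`. -/
theorem fin_two_eq_or_eq_inv_of_commute {g h : SL₂}
    (hD : trace (g : Matrix (Fin 2) (Fin 2) F) ^ 2 ≠ 4) (hc : Commute g h)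
    (ht : trace (h : Matrix (Fin 2) (Fin 2) F) = trace (g : Matrix (Fin 2) (Fin 2) F)) :
    h = g ∨ h = g⁻¹ := by
  have hg := fin_two_det_eq g
  have hh := fin_two_det_eq h
  rw [fin_two_commute_iff] at hc
  obtain ⟨c1, c2, c3⟩ := hc
  rw [trace_fin_two] at hD ht
  rw [trace_fin_two] at ht
  have hinv : h 0 0 = g 1 1 → h 0 1 = -g 0 1 → h 1 0 = -g 1 0 → h 1 1 = g 0 0 → h = g⁻¹ := by
    intro h1 h2 h3 h4
    apply fin_two_ext <;> simp [coe_inv, adjugate_fin_two, *]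
  have heq : h 0 0 = g 0 0 → h 0 1 = g 0 1 → h 1 0 = g 1 0 → h 1 1 = g 1 1 → h = g :=
    fin_two_ext
  generalize g 0 0 = a, g 0 1 = b, g 1 0 = c, g 1 1 = d, h 0 0 = e, h 0 1 = f,
    h 1 0 = k, h 1 1 = l at *
  have hD' : (d - a) ^ 2 + 4 * b * c ≠ 0 := fun h => hD (by linear_combination h + 4 * hg)
  -- `s` is the ratio of the parallel vectors of `h` and `g`, read off by pairing with `g` under the
  -- polar form of the discriminant.
  obtain ⟨s, hs⟩ : ∃ s, s * ((d - a) ^ 2 + 4 * b * c) =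
    (d - a) * (l - e) + 2 * b * k + 2 * c * f := ⟨_, div_mul_cancel₀ _ hD'⟩
  have hf : f = s * b := mul_right_cancel₀ hD' (by
    linear_combination -b * hs - (d - a) * c2 - 2 * b * c1)
  have hk : k = s * c := mul_right_cancel₀ hD' (by
    linear_combination -c * hs - (d - a) * c3 + 2 * c * c1)
  have hl : l - e = s * (d - a) := mul_right_cancel₀ hD' (by
    linear_combination -(d - a) * hs + 2 * c * c2 + 2 * b * c3)
  -- Equal trace and determinant give equal discriminants.
  have hs2 : s ^ 2 = 1 := mul_right_cancel₀ hD' (by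
    have : (l - e) ^ 2 + 4 * f * k = (d - a) ^ 2 + 4 * b * c := by
      linear_combination (e + l + a + d) * ht + 4 * hg - 4 * hh
    rw [hf, hk, hl] at this
    linear_combination this)
  -- In characteristic 2 the sign of `s` does not separate `g` from `g⁻¹`; this equation on the
  -- corner entry does.
  have hroot : (l - d) * (l - a) = 0 := by
    rw [hf, hk] at hh
    linear_combination l * ht - hh + hg - b * c * hs2
  have hfield : (2 : F) = 0 → ∀ x : F, -x = x := fun h x => by linear_combination -x * h
  rcases eq_or_eq_neg_of_sq_eq_sq s 1 (by rw [hs2, one_pow]) with rfl | rfl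
  · rcases mul_eq_zero.mp hroot with h | h
    · exact Or.inl (heq (by grind) (by grind) (by grind) (by grind))
    · have h2 : (2 : F) * (d - a) = 0 := by linear_combination 2 * h - ht - hl
      rcases mul_eq_zero.mp h2 with h2 | h2
      · have := hfield h2
        exact Or.inr (hinv (by grind) (by grind) (by grind) (by grind))
      · exact Or.inl (heq (by grind) (by grind) (by grind) (by grind))
  · rcases mul_eq_zero.mp hroot with h | h
    · have h2 : (2 : F) * (d - a) = 0 := by linear_combination ht + hl - 2 * h
      rcases mul_eq_zero.mp h2 with h2 | h2
      · have := hfield h2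
        exact Or.inl (heq (by grind) (by grind) (by grind) (by grind))
      · exact Or.inr (hinv (by grind) (by grind) (by grind) (by grind))
    · exact Or.inr (hinv (by grind) (by grind) (by grind) (by grind))

/-- Powers modulo `X² - tX + 1` are linear polynomials. -/
theorem _root_.Polynomial.exists_X_pow_eq_mul_add (t : F) (k : ℕ) :
    ∃ (q : Polynomial F) (u v : F), Polynomial.X ^ k =
      (Polynomial.X ^ 2 - Polynomial.C t * Polynomial.X + 1) * q +
        Polynomial.C u * Polynomial.X + Polynomial.C v := by
  induction k with
  | zero => exact ⟨0, 0, 1, by simp⟩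
  | succ k ih =>
    obtain ⟨q, u, v, h⟩ := ih
    refine ⟨q * Polynomial.X + Polynomial.C u, u * t + v, -u, ?_⟩
    rw [pow_succ, h]
    simp only [map_add, map_mul, map_neg]
    ring

/-- As `g` is not scalar, `1` and `g` are independent, so `g ^ k = 1` forces `X ^ k` to be 1 modulo
the characteristic polynomial. Taking `A` to be the matrices handles elements of equal trace; `A =
F` handles eigenvalues. -/
theorem fin_two_pow_eq_one_of_root {A : Type*} [Ring A] [Algebra F A] {g : SL₂} {k : ℕ}
    (hg : g ^ k = 1) (hZ : g ∉ Subgroup.center SL₂) {a : A}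
    (ha : a ^ 2 - trace (g : Matrix (Fin 2) (Fin 2) F) • a + 1 = 0) : a ^ k = 1 := by
  obtain ⟨q, u, v, h⟩ := Polynomial.exists_X_pow_eq_mul_add
    (trace (g : Matrix (Fin 2) (Fin 2) F)) k
  have h1 := congrArg (Polynomial.aeval (g : Matrix (Fin 2) (Fin 2) F)) h
  have h2 := congrArg (Polynomial.aeval a) h
  simp only [map_add, map_mul, map_sub, map_pow, map_one, Polynomial.aeval_X,
    Polynomial.aeval_C, ← Algebra.smul_def, ha, zero_mul, zero_add] at h2
  have hg2 : (g : Matrix (Fin 2) (Fin 2) F) ^ 2 -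
      trace (g : Matrix (Fin 2) (Fin 2) F) • (g : Matrix (Fin 2) (Fin 2) F) + 1 = 0 := by
    rw [pow_two, fin_two_mul_self]
    abel
  simp only [map_add, map_mul, map_sub, map_pow, map_one, Polynomial.aeval_X,
    Polynomial.aeval_C, ← Algebra.smul_def, hg2, zero_mul, zero_add] at h1
  rw [← coe_pow, hg, coe_one, Algebra.algebraMap_eq_smul_one] at h1
  have e00 := congrFun (congrFun h1 0) 0
  have e01 := congrFun (congrFun h1 0) 1
  have e10 := congrFun (congrFun h1 1) 0
  have e11 := congrFun (congrFun h1 1) 1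
  simp at e00 e01 e10 e11
  have hu : u = 0 := by
    by_contra hu
    refine hZ (fin_two_mem_center (by tauto) (by tauto) (mul_left_cancel₀ hu ?_))
    linear_combination e00 - e11
  have hv : v = 1 := by rw [hu] at e00; linear_combination -e00
  rw [h2, hu, hv, zero_smul, zero_add, map_one]

theorem fin_two_pow_eq_one_of_trace_eq {g h : SL₂} {k : ℕ}
    (hg : g ^ k = 1) (hZ : g ∉ Subgroup.center SL₂)
    (ht : trace (h : Matrix (Fin 2) (Fin 2) F) = trace (g : Matrix (Fin 2) (Fin 2) F)) :
    h ^ k = 1 := by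
  have := fin_two_pow_eq_one_of_root hg hZ (a := (h : Matrix (Fin 2) (Fin 2) F)) (by
    rw [pow_two, fin_two_mul_self, ht]
    abel)
  exact Subtype.ext (by rw [coe_pow, this, coe_one])

/-! ### Counting elements of given trace and Sylow subgroups -/

section Finite

variable [Finite F]

/-- Matrices of determinant one and given trace `t`, in coordinates. -/
theorem fin_two_card_trace_eq (t : F) :
    Nat.card {h : SL₂ // trace (h : Matrix (Fin 2) (Fin 2) F) = t} + Nat.card F =
      Nat.card F * Nat.card F + Nat.card F * Nat.card {a : F // a * (t - a) = 1} := by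
  classical
  have := Fintype.ofFinite F
  let e : {h : SL₂ // trace (h : Matrix (Fin 2) (Fin 2) F) = t} ≃
      Σ a : F, Σ b : F, {c : F // b * c = a * (t - a) - 1} :=
    { toFun := fun h => ⟨h.1 0 0, h.1 0 1, h.1 1 0, by
        have h1 := fin_two_det_eq h.1
        have h2 := h.2
        rw [trace_fin_two] at h2
        linear_combination -h1 + h.1 0 0 * h2⟩
      invFun := fun x => ⟨⟨!![x.1, x.2.1; x.2.2.1, t - x.1], by
        rw [det_fin_two_of, x.2.2.2]
        ring⟩, by simp [trace_fin_two]⟩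
      left_inv := by
        rintro ⟨h, rfl⟩
        apply Subtype.ext
        apply fin_two_ext <;> simp [trace_fin_two]
      right_inv := by
        rintro ⟨a, b, c, h⟩
        simp }
  have hinner : ∀ a b : F, Nat.card {c : F // b * c = a * (t - a) - 1} =
      if b = 0 then (if a * (t - a) = 1 then Nat.card F else 0) else 1 := by
    intro a b
    split_ifs with hb ha
    · simp [hb, ha]
    · have : IsEmpty {c : F // b * c = a * (t - a) - 1} :=
        ⟨fun ⟨c, hc⟩ => ha (by rw [hb] at hc; linear_combination -hc)⟩
      simp
    · rw [Nat.card_eq_one_iff_unique]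
      refine ⟨⟨fun c d => Subtype.ext (mul_left_cancel₀ hb (c.2.trans d.2.symm))⟩,
        ⟨⟨(a * (t - a) - 1) / b, mul_div_cancel₀ _ hb⟩⟩⟩
  -- The `+ 1` replaces the missing `b = 0` among the nonzero `b`, avoiding subtraction in `ℕ`.
  have hmid : ∀ a : F, (∑ b : F, if b = 0 then (if a * (t - a) = 1 then Nat.card F else 0)
      else 1) + 1 = Nat.card F + if a * (t - a) = 1 then Nat.card F else 0 := by
    intro a
    rw [← Finset.add_sum_erase _ _ (Finset.mem_univ 0), if_pos rfl,
      Finset.sum_congr rfl fun b hb => if_neg (Finset.ne_of_mem_erase hb), Finset.sum_const,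
      smul_eq_mul, mul_one, add_assoc, Finset.card_erase_add_one (Finset.mem_univ 0),
      Finset.card_univ, ← Nat.card_eq_fintype_card, add_comm]
  rw [Nat.card_congr e, Nat.card_sigma]
  simp_rw [Nat.card_sigma, hinner]
  have hsum := Finset.sum_congr rfl (fun a (_ : a ∈ (Finset.univ : Finset F)) => hmid a)
  rw [Finset.sum_add_distrib, Finset.sum_add_distrib] at hsum
  simp only [Finset.sum_const, Finset.card_univ, smul_eq_mul, mul_one,
    ← Nat.card_eq_fintype_card, ← Finset.sum_filter] at hsum
  rw [hsum, Nat.card_eq_fintype_card (α := {a : F // a * (t - a) = 1}), Fintype.card_subtype,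
    mul_comm (Nat.card F) (Finset.card _)]

theorem fin_two_two_mul_card_sylow {r : ℕ} [Fact r.Prime] (hr : Odd r) (hrF : (r : F) ≠ 0)
    {g : SL₂} (hg : g ^ r = 1) (h1 : g ≠ 1) :
    Nat.card {h : SL₂ // trace (h : Matrix (Fin 2) (Fin 2) F) =
      trace (g : Matrix (Fin 2) (Fin 2) F)} = 2 * Nat.card (Sylow r SL₂) := by
  have hD := fin_two_trace_sq_ne_four hrF hr hg h1
  have hZ' : ∀ z ∈ Subgroup.center SL₂, z ^ 2 = 1 := fun z => fin_two_sq_eq_one_of_mem_center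
  have hmem : ∀ h : SL₂, h ^ r = 1 → ∃ P : Sylow r SL₂, h ∈ P := by
    intro h hh
    have hp : IsPGroup r (Subgroup.zpowers h) := by
      rintro ⟨x, m, rfl⟩
      refine ⟨1, Subtype.ext ?_⟩
      change (h ^ m) ^ r ^ 1 = 1
      rw [pow_one, ← zpow_natCast, zpow_comm, zpow_natCast, hh, _root_.one_zpow]
    obtain ⟨P, hP⟩ := hp.exists_le_sylow
    exact ⟨P, hP (Subgroup.mem_zpowers h)⟩
  obtain ⟨P₀, hP₀⟩ := hmem g hg
  have hZ : g ∉ Subgroup.center SL₂ := fun h =>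
    h1 (P₀.isPGroup'.eq_one_of_sq_eq_one hr hP₀ (hZ' g h))
  have hne : ∀ h : SL₂, trace (h : Matrix (Fin 2) (Fin 2) F) =
      trace (g : Matrix (Fin 2) (Fin 2) F) → h ≠ 1 := by
    rintro h ht rfl
    rw [coe_one, trace_one] at ht
    rw [← ht] at hD
    norm_num at hD
  refine Sylow.card_eq_two_mul {h : SL₂ | trace (h : Matrix (Fin 2) (Fin 2) F) =
      trace (g : Matrix (Fin 2) (Fin 2) F)} ?_ ?_
  · intro h ht
    obtain ⟨P, hP⟩ := hmem h (fin_two_pow_eq_one_of_trace_eq hg hZ ht)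
    exact ⟨P, hP, fun Q hQ => Sylow.eq_of_mem_of_commute_transitive hr hZ'
      fin_two_commute_of_commute Q P hQ hP (hne h ht)⟩
  · intro P
    -- Sylow subgroups are conjugate, so each contains a conjugate of `g`, of the same trace.
    obtain ⟨x, rfl⟩ := MulAction.exists_smul_eq SL₂ P₀ P
    set h := x * g * x⁻¹ with hh
    have ht := fin_two_trace_conj x g
    have hP : h ∈ x • P₀ := Subgroup.smul_mem_pointwise_smul _ (MulAut.conj x) _ hP₀
    have hset : {y | y ∈ {h : SL₂ | trace (h : Matrix (Fin 2) (Fin 2) F) =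
        trace (g : Matrix (Fin 2) (Fin 2) F)} ∧ y ∈ x • P₀} = {h, h⁻¹} := by
      ext y
      constructor
      · rintro ⟨hy, hyP⟩
        refine fin_two_eq_or_eq_inv_of_commute (by rwa [ht])
          ((x • P₀).commute_of_commute_transitive hr hZ' fin_two_commute_of_commute hP hyP) ?_
        rw [ht]; exact hy
      · rintro (rfl | rfl)
        · exact ⟨ht, hP⟩
        · exact ⟨(fin_two_trace_inv h).trans ht, inv_mem hP⟩
    have hinv : h ≠ h⁻¹ := fun hi => hne h ht
      ((x • P₀).isPGroup'.eq_one_of_sq_eq_one hr hP (by rw [pow_two, ← eq_inv_iff_mul_eq_one, ← hi]))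
    change Set.ncard {y | y ∈ {h : SL₂ | trace (h : Matrix (Fin 2) (Fin 2) F) =
        trace (g : Matrix (Fin 2) (Fin 2) F)} ∧ y ∈ x • P₀} = 2
    rw [hset, Set.ncard_pair hinv]

end Finite

end Matrix.SpecialLinearGroup

/-! ### The split case `r ∣ Q - 1` and the nonsplit case `r ∣ Q + 1` -/

namespace Matrix.SpecialLinearGroup

variable {F : Type*} [Field F] [Finite F]

local notation "SL₂" => SpecialLinearGroup (Fin 2) F

theorem fin_two_card_sylow_of_dvd_sub_one {r : ℕ} [Fact r.Prime] (hr : Odd r)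
    (hrF : (r : F) ≠ 0) (hdvd : r ∣ Nat.card F - 1) :
    2 * Nat.card (Sylow r SL₂) = Nat.card F * (Nat.card F + 1) := by
  have := Fintype.ofFinite F
  rw [← Nat.card_units] at hdvd
  obtain ⟨z, hz⟩ := exists_prime_orderOf_dvd_card' r hdvd
  have hzr : (z : F) ^ r = 1 := by
    rw [← Units.val_pow_eq_pow_val, ← hz, pow_orderOf_eq_one, Units.val_one]
  have hz1 : (z : F) ≠ 1 := by
    intro h
    rw [Units.val_eq_one.mp h, orderOf_one] at hz
    exact (Fact.out : r.Prime).one_lt.ne hz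
  have hzz : (z : F) * (z : F)⁻¹ = 1 := mul_inv_cancel₀ z.ne_zero
  -- A split element of order `r`: both eigenvalues lie in `F`, whence two roots.
  let g : SL₂ := ⟨diagonal ![(z : F), (z : F)⁻¹], by simp⟩
  have hg : g ^ r = 1 := by
    apply Subtype.ext
    rw [coe_pow]
    change diagonal ![(z : F), (z : F)⁻¹] ^ r = 1
    rw [diagonal_pow, ← diagonal_one]
    congr 1
    ext i
    fin_cases i <;> simp [hzr]
  have hg1 : g ≠ 1 := by
    intro h
    have := congrArg (fun x : SL₂ => x 0 0) h
    simp [g] at this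
    exact hz1 (by simpa using this)
  have ht : trace (g : Matrix (Fin 2) (Fin 2) F) = z + (z : F)⁻¹ := by
    simp [g]
  have hD := fin_two_trace_sq_ne_four hrF hr hg hg1
  have hne : (z : F) ≠ (z : F)⁻¹ := by
    intro h
    apply hD
    rw [ht]
    linear_combination ((z : F) - (z : F)⁻¹) * h + 4 * hzz
  have hroots : Nat.card {a : F // a * (trace (g : Matrix (Fin 2) (Fin 2) F) - a) = 1} = 2 := by
    change Set.ncard {a : F | a * (trace (g : Matrix (Fin 2) (Fin 2) F) - a) = 1} = 2
    have : {a : F | a * (trace (g : Matrix (Fin 2) (Fin 2) F) - a) = 1} =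
        {(z : F), (z : F)⁻¹} := by
      ext a
      rw [Set.mem_ofPred_eq, Set.mem_insert_iff, Set.mem_singleton_iff, ht,
        ← sub_eq_zero (b := (z : F)), ← sub_eq_zero (b := (z : F)⁻¹), ← mul_eq_zero]
      constructor <;> intro h
      · linear_combination hzz - h
      · linear_combination hzz - h
    rw [this, Set.ncard_pair hne]
  have h := fin_two_card_trace_eq (trace (g : Matrix (Fin 2) (Fin 2) F))
  rw [hroots, fin_two_two_mul_card_sylow hr hrF hg hg1] at h
  linarith

theorem fin_two_card_sylow_of_dvd_add_one {r : ℕ} [Fact r.Prime] (hr : Odd r)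
    (hrF : (r : F) ≠ 0) (hdvd : r ∣ Nat.card F + 1) :
    2 * Nat.card (Sylow r SL₂) + Nat.card F = Nat.card F * Nat.card F := by
  have := Fintype.ofFinite F
  have hq : 1 < Nat.card F := Finite.one_lt_card
  have hcop : r.Coprime (Nat.card F - 1) := by
    rw [(Fact.out : r.Prime).coprime_iff_not_dvd]
    intro h
    have h2 : r ∣ 2 := by
      have := Nat.dvd_sub hdvd h
      rwa [show Nat.card F + 1 - (Nat.card F - 1) = 2 by omega] at this
    have h3 := (Nat.prime_dvd_prime_iff_eq Fact.out Nat.prime_two).mp h2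
    rw [h3] at hr
    exact absurd hr (by decide)
  have hunit : ∀ u : Fˣ, u ^ r = 1 → u = 1 := by
    intro u hu
    rw [← orderOf_eq_one_iff]
    refine Nat.eq_one_of_dvd_coprimes hcop (orderOf_dvd_of_pow_eq_one hu) ?_
    rw [← Nat.card_units]
    exact orderOf_dvd_natCard u
  have hGL : r ∣ Nat.card (GL (Fin 2) F) := by
    rw [card_GL_field, Fin.prod_univ_two, ← Nat.card_eq_fintype_card]
    refine Dvd.dvd.mul_right ?_ _
    have : Nat.card F ^ 2 - Nat.card F ^ ((0 : Fin 2) : ℕ) =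
        (Nat.card F + 1) * (Nat.card F - 1) := by
      simpa using Nat.sq_sub_sq (Nat.card F) 1
    rw [this]
    exact hdvd.mul_right _
  obtain ⟨x, hx⟩ := exists_prime_orderOf_dvd_card' r hGL
  have hxr : x ^ r = 1 := hx ▸ pow_orderOf_eq_one x
  -- `F` has no nontrivial `r`-th root of unity, so Cauchy's element of GL₂ already lies in SL₂.
  have hdet : GeneralLinearGroup.det x = 1 := hunit _ (by rw [← map_pow, hxr, map_one])
  let g : SL₂ := ⟨x.1, congrArg Units.val hdet⟩
  have hg : g ^ r = 1 := by
    apply Subtype.ext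
    rw [coe_pow]
    exact congrArg Units.val hxr
  have hg1 : g ≠ 1 := by
    intro h
    have : x = 1 := Units.ext (congrArg Subtype.val h)
    rw [this, orderOf_one] at hx
    exact (Fact.out : r.Prime).one_lt.ne hx
  have hD := fin_two_trace_sq_ne_four hrF hr hg hg1
  have hZ : g ∉ Subgroup.center SL₂ := by
    intro h
    obtain ⟨m, hm⟩ := hr
    rw [hm, pow_succ, pow_mul, fin_two_sq_eq_one_of_mem_center h, one_pow, one_mul] at hg
    exact hg1 hg
  -- An eigenvalue in `F` would be an `r`-th root of unity, hence 1, making the trace 2.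
  have hroots : IsEmpty {a : F // a * (trace (g : Matrix (Fin 2) (Fin 2) F) - a) = 1} := by
    refine ⟨fun ⟨a, ha⟩ => hD ?_⟩
    have har : a ^ r = 1 := fin_two_pow_eq_one_of_root hg hZ (by
      rw [smul_eq_mul]
      linear_combination -ha)
    have ha0 : a ≠ 0 := left_ne_zero_of_mul_eq_one ha
    have ha1 : a = 1 := congrArg Units.val (hunit (Units.mk0 a ha0) (Units.ext har))
    rw [ha1] at ha
    have ht : trace (g : Matrix (Fin 2) (Fin 2) F) = 2 := by linear_combination ha
    rw [ht]
    norm_num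
  have h := fin_two_card_trace_eq (trace (g : Matrix (Fin 2) (Fin 2) F))
  rwa [@Nat.card_of_isEmpty _ hroots, mul_zero, add_zero, fin_two_two_mul_card_sylow hr hrF hg hg1] at h

end Matrix.SpecialLinearGroup

/-! ### Descent to PSL₂ and the final count -/

open Matrix in
theorem Matrix.ProjectiveSpecialLinearGroup.fin_two_card_sylow {F : Type*} [Field F] [Finite F]
    {r : ℕ} [Fact r.Prime] (hr : Odd r) :
    Nat.card (Sylow r (ProjectiveSpecialLinearGroup (Fin 2) F)) =
        Nat.card (Sylow r (SpecialLinearGroup (Fin 2) F)) ∧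
      ∀ P Q : Sylow r (ProjectiveSpecialLinearGroup (Fin 2) F), P ≠ Q →
        (P : Subgroup (ProjectiveSpecialLinearGroup (Fin 2) F)) ⊓ Q = ⊥ := by
  have hZ : ∀ z ∈ Subgroup.center (SpecialLinearGroup (Fin 2) F), z ^ 2 = 1 :=
    fun z => SpecialLinearGroup.fin_two_sq_eq_one_of_mem_center
  have hker := QuotientGroup.ker_mk' (Subgroup.center (SpecialLinearGroup (Fin 2) F))
  exact Sylow.card_eq_and_inf_eq_bot_of_surjective
    (QuotientGroup.mk'_surjective (Subgroup.center (SpecialLinearGroup (Fin 2) F))) hr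
    (by rwa [hker]) hker.le
    fun P Q x hP hQ hx => Sylow.eq_of_mem_of_commute_transitive hr hZ
      SpecialLinearGroup.fin_two_commute_of_commute P Q hP hQ hx

theorem FiniteField.natCast_ne_zero_of_coprime {F : Type*} [Field F] [Finite F] {r : ℕ}
    (h : r.Coprime (Nat.card F)) : (r : F) ≠ 0 := by
  intro h0
  have := Fintype.ofFinite F
  have hF : (Nat.card F : F) = 0 := by rw [Nat.card_eq_fintype_card, Nat.cast_card_eq_zero]
  have h1 : ((r : ℤ) * r.gcdA (Nat.card F) + Nat.card F * r.gcdB (Nat.card F) : ℤ) = 1 := by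
    rw [← Nat.gcd_eq_gcd_ab, h.gcd_eq_one, Nat.cast_one]
  have h2 := congrArg (Int.cast : ℤ → F) h1
  push_cast at h2
  rw [h0, hF] at h2
  simp at h2

theorem mainTheorem12 (p n : ℕ) (hp : p.Prime) (hn : 0 < n)
    (F : Type*) [Field F] (hF : Nat.card F = p ^ n) :
    (∀ r : ℕ, r.Prime → Odd r → r ∣ p ^ n + 1 →
      Nat.card (Sylow r (Matrix.ProjectiveSpecialLinearGroup (Fin 2) F)) =
          p ^ n * (p ^ n - 1) / 2 ∧
      ∀ P Q : Sylow r (Matrix.ProjectiveSpecialLinearGroup (Fin 2) F), P ≠ Q →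
        (P : Subgroup (Matrix.ProjectiveSpecialLinearGroup (Fin 2) F)) ⊓ Q = ⊥) ∧
    (∀ q : ℕ, q.Prime → Odd q → q ∣ p ^ n - 1 →
      Nat.card (Sylow q (Matrix.ProjectiveSpecialLinearGroup (Fin 2) F)) =
          p ^ n * (p ^ n + 1) / 2 ∧
      ∀ P Q : Sylow q (Matrix.ProjectiveSpecialLinearGroup (Fin 2) F), P ≠ Q →
        (P : Subgroup (Matrix.ProjectiveSpecialLinearGroup (Fin 2) F)) ⊓ Q = ⊥) ∧
    (∀ r q : ℕ, r.Prime → Odd r → r ∣ p ^ n + 1 → q.Prime → Odd q → q ∣ p ^ n - 1 →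
      ∀ (P : Sylow r (Matrix.ProjectiveSpecialLinearGroup (Fin 2) F))
        (Q : Sylow q (Matrix.ProjectiveSpecialLinearGroup (Fin 2) F)),
        (P : Subgroup (Matrix.ProjectiveSpecialLinearGroup (Fin 2) F)) ⊓ Q = ⊥) := by
  have hQ : 1 < p ^ n := Nat.one_lt_pow hn.ne' hp.one_lt
  have hfin : Finite F := Nat.finite_of_card_ne_zero (by omega)
  refine ⟨?_, ?_, ?_⟩
  · intro r hr hodd hdvd
    have := Fact.mk hr
    obtain ⟨h1, h2⟩ := Matrix.ProjectiveSpecialLinearGroup.fin_two_card_sylow (F := F) hodd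
    refine ⟨?_, h2⟩
    have hrF : (r : F) ≠ 0 := FiniteField.natCast_ne_zero_of_coprime (by
      rw [hF]
      exact Nat.Coprime.coprime_dvd_left hdvd (by simp))
    rw [← hF] at hdvd
    have h := Matrix.SpecialLinearGroup.fin_two_card_sylow_of_dvd_add_one hodd hrF hdvd
    rw [h1]
    rw [hF] at h
    have h3 : p ^ n * (p ^ n - 1) + p ^ n = p ^ n * p ^ n := by
      rw [← Nat.mul_succ, Nat.succ_eq_add_one, Nat.sub_add_cancel hQ.le]
    omega
  · intro r hr hodd hdvd
    have := Fact.mk hr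
    obtain ⟨h1, h2⟩ := Matrix.ProjectiveSpecialLinearGroup.fin_two_card_sylow (F := F) hodd
    refine ⟨?_, h2⟩
    have hrF : (r : F) ≠ 0 := FiniteField.natCast_ne_zero_of_coprime (by
      rw [hF]
      exact Nat.Coprime.coprime_dvd_left hdvd
        ((Nat.coprime_self_sub_left hQ.le).mpr (Nat.coprime_one_left _)))
    rw [← hF] at hdvd
    have h := Matrix.SpecialLinearGroup.fin_two_card_sylow_of_dvd_sub_one hodd hrF hdvd
    rw [h1]
    rw [hF] at h
    omega
  · intro r q hr hrodd hrd hq hqodd hqd P Q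
    refine (IsPGroup.disjoint_of_coprime P.isPGroup' Q.isPGroup' ?_).eq_bot
    rw [Nat.coprime_primes hr hq]
    rintro rfl
    have h2 : r ∣ 2 := by
      have := Nat.dvd_sub hrd hqd
      rwa [show p ^ n + 1 - (p ^ n - 1) = 2 by omega] at this
    have h3 := (Nat.prime_dvd_prime_iff_eq hr Nat.prime_two).mp h2
    rw [h3] at hrodd
    exact absurd hrodd (by decide)
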